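/- Let $M$ be a smooth ($C^\infty$, Hausdorff, boundaryless) real manifold of dimension $n$, let $J$ be a smooth almost complex structure on $M$ (a smooth $(1,1)$-tensor field with $J^2=-\mathrm{Id}$; so $n$ is even if $M\neq\emptyset$), and let $\nabla$ be a smooth connection on $TM$ with torsion $T$. Let $\pi:T^*M\to M$ be the projection and, for $\xi\in T^*M$ with $\pi(\xi)=x$, regard $T_x^*M\subseteq T_\xi T^*M$ as the vertical space. With the induced connection $(\nabla_Xs)(Y)=X.s(Y)-s(\nabla_XY)$ on one-forms, put $$H^\nabla_\xi=\{d_xs(X): X\in T_xM,\ s \text{ a smooth one-form},\ s(x)=\xi,\ \nabla_Xs=0\}.$$ The generalized horizontal lift $J^{G,\nabla}$ is the field of endomorphisms of the spaces $T_\xi T^*M=H^\nabla_\xi\oplus T^*_xM$ given by $J^{G,\nabla}(h+\alpha)=h'+\alpha\circ J$ for $h\in H^\nabla_\xi$, $\alpha\in T_x^*M$, where $h'\in H^\nabla_\xi$ is the vector with $d_\xi\pi(h')=J\,d_\xi\pi(h)$. Let $\theta$ be the Liouville form, $\theta_\xi(Y)=\xi(d_\xi\pi(Y))$, let $\omega_{st}=d\theta$,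 and let $\theta(J)$ be the one-form on $T^*M$ with $\theta(J)_\xi(Y)=\xi(J\,d_\xi\pi(Y))$. The complete lift $J^c$ is the field of endomorphisms of the tangent spaces of $T^*M$ defined by $d(\theta(J))=\omega_{st}(J^c\cdot,\cdot)$. For a $(1,2)$-tensor field $R=R^k_{i,j}\,dx^i\otimes dx^j\otimes\partial x_k$ on $M$, let $\gamma(R)=p_kR^k_{i,j}\,dx^i\otimes\partial p_j$, i.e. $\gamma(R)_\xi(Y)$ is the vertical vector $\xi(R(d_\xi\pi(Y),\cdot))$. Finally let $(\nabla J)(X,Y)=\nabla_X(JY)-J\nabla_XY$ and let $S$ be the $(1,2)$-tensor field $$S(X,Y)=-(\nabla J)(X,Y)+(\nabla J)(Y,X)+T(JX,Y)-JT(X,Y).$$ Then the definitions of $J^{G,\nabla}$ and of $J^c$ each determine exactly one field of endomorphisms of the tangent spaces of $T^*M$, and: (1) For every smooth chart $(x_1,\dots,x_n)$ of $M$, with $J\partial x_j=J^i_j\,\partial x_i$, $\nabla_{\partial x_i}\partial x_j=\Gamma^k_{i,j}\,\partial x_k$, the associated local coordinates $(x_1,\dots,x_n,p_1,\dots,p_n)$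 of $T^*M$ (where $\xi=p_i\,dx^i$) and $\Gamma_{i,j}=p_k\Gamma^k_{i,j}$ (repeated indices are summed over), the matrix of $J^{G,\nabla}$ in the basis $\partial x_1,\dots,\partial x_n,\partial p_1,\dots,\partial p_n$ is $$J^{G,\nabla}=\begin{pmatrix}J^i_j&0\\ \Gamma_{l,i}J^l_j-\Gamma_{j,l}J^l_i&J^j_i\end{pmatrix},$$ where $i$ is the row index and $j$ the column index of each block. (2) $J^{G,\nabla}=J^c+\gamma(S)$. -/

import Mathlib

open Bundle Set
open scoped Manifold ContDiff Topology

noncomputable section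

namespace CotangentLift

/-- The Euclidean space `ℝⁿ` on which an `n`-dimensional manifold is modelled. -/
abbrev Model (n : ℕ) : Type := EuclideanSpace ℝ (Fin n)

section Basic

variable {n : ℕ} {M : Type*} [TopologicalSpace M] [ChartedSpace (Model n) M]

/-- The cotangent space `T_x^* M`. -/
abbrev CotangentSpace (x : M) : Type :=
  TangentSpace (𝓡 n) x →L[ℝ] Bundle.Trivial M ℝ x

variable [IsManifold (𝓡 n) ∞ M]

variable (n M) in
/-- The total space `T^* M` of the cotangent bundle, with Mathlib's topology and smooth structure
of a bundle of continuous linear maps. -/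
abbrev CotangentBundle : Type _ :=
  TotalSpace (Model n →L[ℝ] ℝ) (fun x : M => CotangentSpace (n := n) x)

variable (n) in
/-- The model with corners of the manifold `T^* M`. -/
abbrev cotModel : ModelWithCorners ℝ (Model n × (Model n →L[ℝ] ℝ))
    (ModelProd (Model n) (Model n →L[ℝ] ℝ)) :=
  (𝓡 n).prod 𝓘(ℝ, Model n →L[ℝ] ℝ)

/-- The space `T_ξ T^* M`. -/
abbrev TT (ξ : CotangentBundle n M) : Type :=
  TangentSpace (cotModel n) ξ

/-- The differential `d_ξ π : T_ξ T^* M → T_x M` of the projection `π : T^* M → M`, with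
`x = π ξ`. -/
def dproj (ξ : CotangentBundle n M) : TT ξ →L[ℝ] TangentSpace (𝓡 n) ξ.proj :=
  mfderiv (cotModel n) (𝓡 n) (fun η : CotangentBundle n M => η.proj) ξ

/-- The canonical inclusion `T_x^* M → T_ξ T^* M` of the vertical space: the differential at `ξ` of
the inclusion of the fibre `T_x^* M` in `T^* M`, where `x = π ξ`. -/
def vertical (ξ : CotangentBundle n M) : CotangentSpace (n := n) ξ.proj →L[ℝ] TT ξ :=
  mfderiv 𝓘(ℝ, Model n →L[ℝ] ℝ) (cotModel n)
    (fun α : Model n →L[ℝ] ℝ => (⟨ξ.proj, α⟩ : CotangentBundle n M)) ξ.snd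

/-- The smooth vector fields on `M`. -/
def SmoothVectorField (X : Π x : M, TangentSpace (𝓡 n) x) : Prop :=
  ContMDiff (𝓡 n) ((𝓡 n).prod 𝓘(ℝ, Model n)) ∞
    (fun x => (⟨x, X x⟩ : TotalSpace (Model n) (fun x : M => TangentSpace (𝓡 n) x)))

/-- The smooth one-forms on `M`, i.e. the smooth sections of `T^* M`. -/
def SmoothOneForm (s : Π x : M, CotangentSpace (n := n) x) : Prop :=
  ContMDiff (𝓡 n) (cotModel n) ∞ (fun x => (⟨x, s x⟩ : CotangentBundle n M))

variable (n M) in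
/-- An almost complex structure on `M`: a smooth field `J` of endomorphisms of the tangent spaces
with `J² = -Id`. -/
structure AlmostComplexStructure where
  /-- the endomorphism `J x` of `T_x M` -/
  toFun : Π x : M, TangentSpace (𝓡 n) x →L[ℝ] TangentSpace (𝓡 n) x
  contMDiff : ContMDiff (𝓡 n) ((𝓡 n).prod 𝓘(ℝ, Model n →L[ℝ] Model n)) ∞
    (fun x => (⟨x, toFun x⟩ : TotalSpace (Model n →L[ℝ] Model n)
      (fun x : M => TangentSpace (𝓡 n) x →L[ℝ] TangentSpace (𝓡 n) x)))
  sq : ∀ (x : M) (v : TangentSpace (𝓡 n) x), toFun x (toFun x v) = -v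

instance : CoeFun (AlmostComplexStructure n M)
    (fun _ => Π x : M, TangentSpace (𝓡 n) x →L[ℝ] TangentSpace (𝓡 n) x) :=
  ⟨AlmostComplexStructure.toFun⟩

variable (n M) in
/-- A connection on `M`, i.e. a covariant derivative on `TM`. In Mathlib's convention
`cov Y x (X x)` is the value at `x` of `∇_X Y`. -/
abbrev Connection : Type _ :=
  CovariantDerivative (𝓡 n) (Model n) (fun x : M => TangentSpace (𝓡 n) x)

/-! ### The horizontal distribution and the generalized horizontal lift -/

/-- The value at `x` of `(∇_X s)(Y) = X.s(Y) - s(∇_X Y)`, where `∇` is the induced connection on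
the cotangent bundle; it depends on the vector field `X` only through its value `X` at `x`. -/
def dualDeriv (cov : Connection n M) {x : M} (X : TangentSpace (𝓡 n) x)
    (s : Π y : M, CotangentSpace (n := n) y) (Y : Π y : M, TangentSpace (𝓡 n) y) : ℝ :=
  mvfderiv (𝓡 n) (fun y : M => (s y (Y y) : ℝ)) x X - (s x (cov Y x X) : ℝ)

/-- The horizontal distribution `H^∇_ξ = {d_x s(X) : X ∈ T_x M, s(x) = ξ, ∇_X s = 0}`. -/
def horizontal (cov : Connection n M) (ξ : CotangentBundle n M) : Set (TT ξ) :=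
  {Y | ∃ (X : TangentSpace (𝓡 n) ξ.proj) (s : Π x : M, CotangentSpace (n := n) x),
    SmoothOneForm s ∧ s ξ.proj = ξ.snd ∧
    (∀ Z : Π x : M, TangentSpace (𝓡 n) x, SmoothVectorField Z → dualDeriv cov X s Z = 0) ∧
    Y = mfderiv (𝓡 n) (cotModel n) (fun x => (⟨x, s x⟩ : CotangentBundle n M)) ξ.proj X}

variable (n M) in
/-- Fields of endomorphisms of the tangent spaces of `T^* M`. -/
abbrev EndField : Type _ := Π ξ : CotangentBundle n M, TT ξ →L[ℝ] TT ξ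

/-- `A` is the product structure `J ⊕ ᵗJ` with respect to the decomposition
`T_ξ T^* M = H^∇_ξ ⊕ T_x^* M`: it maps `h + α`, with `h` horizontal and `α` vertical, to
`h' + α ∘ J`, where `h'` is the horizontal vector with `dπ h' = J (dπ h)`. -/
def IsGeneralizedHorizontalLift (J : AlmostComplexStructure n M) (cov : Connection n M)
    (A : EndField n M) : Prop :=
  ∀ ξ : CotangentBundle n M, ∀ h ∈ horizontal cov ξ, ∀ h' ∈ horizontal cov ξ,
    dproj ξ h' = J ξ.proj (dproj ξ h) →
    ∀ α : CotangentSpace (n := n) ξ.proj,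
      A ξ (h + vertical ξ α) = h' + vertical ξ (α.comp (J ξ.proj))

/-- The generalized horizontal lift `J^{G,∇}`. -/
def generalizedHorizontalLift (J : AlmostComplexStructure n M) (cov : Connection n M) :
    EndField n M :=
  Classical.epsilon (IsGeneralizedHorizontalLift J cov)

/-! ### The Liouville form, the canonical symplectic form and the complete lift -/

variable (n M) in
/-- One-forms on `T^* M`. -/
abbrev OneForm : Type _ := Π ξ : CotangentBundle n M, TT ξ →L[ℝ] ℝ

/-- The expression `Σ_a β_a dz^a` of a one-form `β` on `T^* M` in the preferred chart at `ξ`. -/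
def OneForm.inChart (β : OneForm n M) (ξ : CotangentBundle n M)
    (z : Model n × (Model n →L[ℝ] ℝ)) : (Model n × (Model n →L[ℝ] ℝ)) →L[ℝ] ℝ :=
  (β ((extChartAt (cotModel n) ξ).symm z)).comp
    (mfderiv 𝓘(ℝ, Model n × (Model n →L[ℝ] ℝ)) (cotModel n) (extChartAt (cotModel n) ξ).symm z)

/-- The exterior derivative `(dβ)_ξ(Y, Z)` of a one-form on `T^* M`. In a chart with coordinates
`z^a` it is `Σ_{a,b} ∂_a β_b (Y^a Z^b - Z^a Y^b)`. -/
def OneForm.d (β : OneForm n M) (ξ : CotangentBundle n M) (Y Z : TT ξ) : ℝ :=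
  let φ := extChartAt (cotModel n) ξ
  let dφ : TT ξ →L[ℝ] Model n × (Model n →L[ℝ] ℝ) :=
    mvfderiv (cotModel n) φ ξ
  fderiv ℝ (β.inChart ξ) (φ ξ) (dφ Y) (dφ Z) - fderiv ℝ (β.inChart ξ) (φ ξ) (dφ Z) (dφ Y)

variable (n M) in
/-- The Liouville form `θ = p_i dx^i`, that is `θ_ξ(Y) = ξ(dπ Y)`. -/
def liouville : OneForm n M := fun ξ => ContinuousLinearMap.comp ξ.snd (dproj ξ)

/-- The canonical symplectic form `ω_st = dθ`. -/
def omegaSt (ξ : CotangentBundle n M) (Y Z : TT ξ) : ℝ := (liouville n M).d ξ Y Z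

/-- The one-form `θ(J) = p_k J^k_l dx^l`, that is `θ(J)_ξ(Y) = ξ(J dπ Y)`. -/
def thetaJ (J : AlmostComplexStructure n M) : OneForm n M :=
  fun ξ => (ContinuousLinearMap.comp ξ.snd (J ξ.proj)).comp (dproj ξ)

/-- The identity `d(θ(J)) = ω_st(A · , ·)` which defines the complete lift. -/
def IsCompleteLift (J : AlmostComplexStructure n M) (A : EndField n M) : Prop :=
  ∀ (ξ : CotangentBundle n M) (Y Z : TT ξ), (thetaJ J).d ξ Y Z = omegaSt ξ (A ξ Y) Z

/-- The complete lift `J^c`. -/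
def completeLift (J : AlmostComplexStructure n M) : EndField n M :=
  Classical.epsilon (IsCompleteLift J)

/-! ### The contraction `γ` and the tensor `S` -/

/-- The contraction `γ(R) = p_k R^k_{i,j} dx^i ⊗ ∂p_j` of a tensor `R` of type `(1,2)` on `M`:
it maps `Y ∈ T_ξ T^* M` to the vertical vector given by the covector `ξ(R(dπ Y, · ))`. -/
def gammaContraction
    (R : Π x : M, TangentSpace (𝓡 n) x →L[ℝ] TangentSpace (𝓡 n) x →L[ℝ] TangentSpace (𝓡 n) x) :
    EndField n M :=
  fun ξ => (vertical ξ).comp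
    ((ContinuousLinearMap.postcomp (TangentSpace (𝓡 n) ξ.proj) ξ.snd).comp
      ((R ξ.proj).comp (dproj ξ)))

/-- `(∇J)(X, Y) = ∇_X (JY) - J ∇_X Y`, for vector fields `X` and `Y`. -/
def nablaJ (J : AlmostComplexStructure n M) (cov : Connection n M)
    (X Y : Π x : M, TangentSpace (𝓡 n) x) : Π x : M, TangentSpace (𝓡 n) x :=
  fun x => cov (fun y => J y (Y y)) x (X x) - J x (cov Y x (X x))

/-- `S(X, Y) = -(∇J)(X, Y) + (∇J)(Y, X) + T(JX, Y) - J T(X, Y)`, for vector fields `X` and `Y`,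
where `T` is the torsion of `∇`. -/
def SField (J : AlmostComplexStructure n M) (cov : Connection n M)
    (X Y : Π x : M, TangentSpace (𝓡 n) x) : Π x : M, TangentSpace (𝓡 n) x :=
  fun x => -(nablaJ J cov X Y x) + nablaJ J cov Y X x
    + cov.torsion x (J x (X x)) (Y x) - J x (cov.torsion x (X x) (Y x))

lemma AlmostComplexStructure.mdifferentiableAt_apply (J : AlmostComplexStructure n M) {x : M}
    {Y : Π x : M, TangentSpace (𝓡 n) x}
    (hY : MDifferentiableAt (𝓡 n) ((𝓡 n).prod 𝓘(ℝ, Model n))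
      (fun y => (⟨y, Y y⟩ : TotalSpace (Model n) (fun x : M => TangentSpace (𝓡 n) x))) x) :
    MDifferentiableAt (𝓡 n) ((𝓡 n).prod 𝓘(ℝ, Model n))
      (fun y => (⟨y, J y (Y y)⟩ : TotalSpace (Model n) (fun x : M => TangentSpace (𝓡 n) x))) x :=
  MDifferentiableAt.clm_bundle_apply (J.contMDiff.mdifferentiable (by simp) x) hY

lemma nablaJ_tensorial (J : AlmostComplexStructure n M) (cov : Connection n M)
    (X : Π x : M, TangentSpace (𝓡 n) x) (x : M) :
    TensorialAt (𝓡 n) (Model n) (fun Y => nablaJ J cov X Y x) x where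
  smul {f σ} hf hσ := by
    have h1 := cov.isCovariantDerivativeOnUniv.leibniz (J.mdifferentiableAt_apply hσ) hf
    have h2 := cov.isCovariantDerivativeOnUniv.leibniz hσ hf
    have e : (fun y => J y ((f • σ) y)) = f • (fun y => J y (σ y)) := by
      ext1 y; simp
    simp only [nablaJ, e, h1, h2]
    simp
    module
  add {σ σ'} hσ hσ' := by
    have h1 := cov.isCovariantDerivativeOnUniv.add (J.mdifferentiableAt_apply hσ)
      (J.mdifferentiableAt_apply hσ')
    have h2 := cov.isCovariantDerivativeOnUniv.add hσ hσ'
    have e : (fun y => J y ((σ + σ') y)) = (fun y => J y (σ y)) + (fun y => J y (σ' y)) := by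
      ext1 y; simp
    simp only [nablaJ, e, h1, h2]
    simp
    module

lemma SField_tensorial_left (J : AlmostComplexStructure n M) (cov : Connection n M)
    (Y : Π x : M, TangentSpace (𝓡 n) x) (x : M) :
    TensorialAt (𝓡 n) (Model n) (fun X => SField J cov X Y x) x where
  smul {f σ} hf hσ := by
    have h := (nablaJ_tensorial J cov Y x).smul hf hσ
    simp only [SField, h]
    simp [nablaJ]
    module
  add {σ σ'} hσ hσ' := by
    have h := (nablaJ_tensorial J cov Y x).add hσ hσ'
    simp only [SField, h]
    simp [nablaJ]
    module

lemma SField_tensorial_right (J : AlmostComplexStructure n M) (cov : Connection n M)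
    (X : Π x : M, TangentSpace (𝓡 n) x) (x : M) :
    TensorialAt (𝓡 n) (Model n) (fun Y => SField J cov X Y x) x where
  smul {f σ} hf hσ := by
    have h := (nablaJ_tensorial J cov X x).smul hf hσ
    simp only [SField, h]
    simp [nablaJ]
    module
  add {σ σ'} hσ hσ' := by
    have h := (nablaJ_tensorial J cov X x).add hσ hσ'
    simp only [SField, h]
    simp [nablaJ]
    module

/-- The tensor `S` of type `(1,2)` on `M` whose values on vector fields are given by `SField`. -/
def tensorS (J : AlmostComplexStructure n M) (cov : Connection n M) (x : M) :
    TangentSpace (𝓡 n) x →L[ℝ] TangentSpace (𝓡 n) x →L[ℝ] TangentSpace (𝓡 n) x :=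
  TensorialAt.mkHom₂ (fun X Y => SField J cov X Y x) x
    (fun Y _ => SField_tensorial_left J cov Y x) (fun X _ => SField_tensorial_right J cov X x)

/-! ### Local coordinates -/

/-- The coordinate vector field `∂x_i` of a chart `φ = (x_1, …, x_n)` of `M` (relevant on the
domain of `φ`). -/
def coordVector (φ : OpenPartialHomeomorph M (Model n)) (i : Fin n) (x : M) :
    TangentSpace (𝓡 n) x :=
  (mvfderiv (𝓡 n) φ x).inverse (EuclideanSpace.single i (1 : ℝ))

/-- The coordinate covector `dx^i` at `x`. -/
def coordCovector (φ : OpenPartialHomeomorph M (Model n)) (i : Fin n) (x : M) :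
    TangentSpace (𝓡 n) x →L[ℝ] ℝ :=
  (EuclideanSpace.proj i : Model n →L[ℝ] ℝ).comp (mvfderiv (𝓡 n) φ x)

/-- The component `J^i_j` of `J`, defined by `J ∂x_j = J^i_j ∂x_i`. -/
def JCoeff (J : AlmostComplexStructure n M) (φ : OpenPartialHomeomorph M (Model n)) (x : M)
    (i j : Fin n) : ℝ :=
  coordCovector φ i x (J x (coordVector φ j x))

/-- The Christoffel symbol `Γ^k_{i,j}`, defined by `∇_{∂x_i} ∂x_j = Γ^k_{i,j} ∂x_k`. -/
def christoffel (cov : Connection n M) (φ : OpenPartialHomeomorph M (Model n)) (x : M)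
    (i j k : Fin n) : ℝ :=
  coordCovector φ k x (cov (coordVector φ j) x (coordVector φ i x))

/-- The coordinate `p_i` on `T^* M`: `ξ = p_i dx^i`, so that `p_i(ξ) = ξ(∂x_i)`. -/
def pCoord (φ : OpenPartialHomeomorph M (Model n)) (i : Fin n) (ξ : CotangentBundle n M) : ℝ :=
  ξ.snd (coordVector φ i ξ.proj)

/-- `Γ_{i,j} = p_k Γ^k_{i,j}`, a function on `T^* M`. -/
def christoffelP (cov : Connection n M) (φ : OpenPartialHomeomorph M (Model n))
    (ξ : CotangentBundle n M) (i j : Fin n) : ℝ :=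
  ∑ k, pCoord φ k ξ * christoffel cov φ ξ.proj i j k

/-- The local coordinates `(x_1, …, x_n, p_1, …, p_n)` on `T^* M` associated with `φ`. -/
def cotCoord (φ : OpenPartialHomeomorph M (Model n)) (ξ : CotangentBundle n M) :
    Fin n ⊕ Fin n → ℝ :=
  Sum.elim (fun i => φ ξ.proj i) (fun i => pCoord φ i ξ)

/-- The components `(dx_1(Y), …, dx_n(Y), dp_1(Y), …, dp_n(Y))` of `Y ∈ T_ξ T^* M` in the basis
`∂x_1, …, ∂x_n, ∂p_1, …, ∂p_n`. -/
def components (φ : OpenPartialHomeomorph M (Model n)) (ξ : CotangentBundle n M) :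
    TT ξ →L[ℝ] (Fin n ⊕ Fin n → ℝ) :=
  mvfderiv (cotModel n) (cotCoord φ) ξ

/-- The block matrix with blocks `J^i_j` and `0` in the first row, and
`Γ_{l,i} J^l_j - Γ_{j,l} J^l_i` and `J^j_i` in the second; `i` is the row and `j` the column of an
entry. -/
def localMatrix (J : AlmostComplexStructure n M) (cov : Connection n M)
    (φ : OpenPartialHomeomorph M (Model n)) (ξ : CotangentBundle n M) :
    Matrix (Fin n ⊕ Fin n) (Fin n ⊕ Fin n) ℝ :=
  Matrix.fromBlocks
    (Matrix.of fun i j => JCoeff J φ ξ.proj i j)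
    0
    (Matrix.of fun i j => ∑ l, (christoffelP cov φ ξ l i * JCoeff J φ ξ.proj l j
      - christoffelP cov φ ξ j l * JCoeff J φ ξ.proj l i))
    (Matrix.of fun i j => JCoeff J φ ξ.proj j i)

end Basic

end CotangentLift

end

/-!
A connection `∇` on `M` induces one on `T^* M`, with connector `K_ξ : T_ξ T^* M → T_x^* M`. The pair
`(dπ, K)` identifies `T_ξ T^* M` with `T_x M × T_x^* M`, the horizontal vectors being those with
`K = 0`, so that `J^{G,∇}` is `J ⊕ ᵗJ`. In local coordinates `K(Y)_i = dp_i(Y) - Γ_{l,i} dx^l(Y)`,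
which gives the matrix. For a field `L` of endomorphisms and `θ(L)_ξ(Y) = ξ(L dπ Y)`,
`dθ(L)(Y, Z) = K(Y)(L dπ Z) - K(Z)(L dπ Y) + ξ((d^∇ L)(dπ Y, dπ Z))`,
where `d^∇ Id = T`. Comparing `L = J` with `L = Id` shows that the two sides of the identity which
defines `J^c` differ, at `J ⊕ ᵗJ`, by the contraction of `T(J · , · ) - d^∇ J`, which is `S`.
-/

noncomputable section

namespace CotangentLift

lemma epsilon_eq_of_forall_iff {α : Type*} [Nonempty α] {p : α → Prop} {a : α}
    (h : ∀ x, p x ↔ x = a) : Classical.epsilon p = a :=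
  (h _).1 (Classical.epsilon_spec ⟨a, (h a).2 rfl⟩)

section Calculus

variable {𝕜 E F : Type*} [NontriviallyNormedField 𝕜] [NormedAddCommGroup E] [NormedSpace 𝕜 E]
  [NormedAddCommGroup F] [NormedSpace 𝕜 F]

lemma differentiableAt_of_forall_clm_apply [CompleteSpace 𝕜] {G : Type*} [NormedAddCommGroup G]
    [NormedSpace 𝕜 G] [FiniteDimensional 𝕜 F] {f : E → F →L[𝕜] G} {z : E}
    (h : ∀ v, DifferentiableAt 𝕜 (fun w => f w v) z) : DifferentiableAt 𝕜 f z := by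
  let b := Module.finBasis 𝕜 F
  have hf : f = fun w => ∑ i,
      (LinearMap.toContinuousLinearMap (b.coord i)).smulRight (f w (b i)) := by
    ext w v
    conv_lhs => rw [← b.sum_repr v]
    simp [-Module.Basis.sum_repr]
  rw [hf]
  exact DifferentiableAt.fun_sum fun i _ =>
    (ContinuousLinearMap.smulRightL 𝕜 F G _).differentiableAt.comp z (h (b i))

lemma fderiv_clm_apply_eq {G : Type*} [NormedAddCommGroup G] [NormedSpace 𝕜 G]
    {f : E → F →L[𝕜] G} {f' : E →L[𝕜] G} {z : E} {v : F} (hf : DifferentiableAt 𝕜 f z)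
    (h : HasFDerivAt (fun w => f w v) f' z) (w : E) : fderiv 𝕜 f z w v = f' w := by
  rw [← (hf.hasFDerivAt.clm_apply (hasFDerivAt_const v z)).unique h]
  simp

lemma lieBracketWithin_eq_zero_of_eventuallyEq_const {V W : E → E} {v w : E} {s : Set E} {z : E}
    (hV : V =ᶠ[𝓝 z] fun _ => v) (hW : W =ᶠ[𝓝 z] fun _ => w) :
    VectorField.lieBracketWithin 𝕜 V W s z = 0 := by
  have h : ∀ {U : E → E} {u : E}, U =ᶠ[𝓝 z] (fun _ => u) → fderivWithin 𝕜 U s z = 0 :=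
    fun hU => hU.fderivWithin_eq_of_nhds.trans (by simp)
  simp [VectorField.lieBracketWithin_eq, h hV, h hW]

end Calculus

section Manifold

variable {E H M : Type*} [NormedAddCommGroup E] [NormedSpace ℝ E] [TopologicalSpace H]
  {I : ModelWithCorners ℝ E H} [TopologicalSpace M] [ChartedSpace H M]

lemma mdifferentiableAt_pi {ι F : Type*} [Fintype ι] [NormedAddCommGroup F] [NormedSpace ℝ F]
    {f : M → ι → F} {x : M} (h : ∀ i, MDiffAt (fun y => f y i) x) :
    MDifferentiableAt I 𝓘(ℝ, ι → F) f x := by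
  rw [mdifferentiableAt_iff]
  exact ⟨continuousAt_pi.2 fun i => (h i).continuousAt,
    differentiableWithinAt_pi.2 fun i => ((mdifferentiableAt_iff _ _).1 (h i)).2⟩

lemma hasMFDerivAt_extChartAt_self [IsManifold I 1 M] (x : M) :
    HasMFDerivAt I 𝓘(ℝ, E) (extChartAt I x) x (ContinuousLinearMap.id ℝ E) := by
  have h := (mdifferentiableAt_extChartAt (I := I) (mem_chart_source H x)).hasMFDerivAt
  rwa [mfderiv_extChartAt_self] at h

lemma mdifferentiableAt_extChartAt_symm [I.Boundaryless] [IsManifold I 1 M] {x : M} {u : E}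
    (hu : u ∈ (extChartAt I x).target) : MDiffAt (extChartAt I x).symm u := by
  have h := mdifferentiableWithinAt_extChartAt_symm hu
  rwa [ModelWithCorners.range_eq_univ, mdifferentiableWithinAt_univ] at h

variable [FiniteDimensional ℝ E] [T2Space M] [IsManifold I ∞ M]

lemma exists_contMDiff_section {F : Type*} [NormedAddCommGroup F] [NormedSpace ℝ F]
    {V : M → Type*} [TopologicalSpace (TotalSpace F V)] [∀ x, AddCommGroup (V x)]
    [∀ x, Module ℝ (V x)] [∀ x, TopologicalSpace (V x)] [FiberBundle F V] [VectorBundle ℝ F V]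
    [ContMDiffVectorBundle ∞ F V I] {x : M} (v : V x) :
    ∃ s : Π y, V y, ContMDiff I (I.prod 𝓘(ℝ, F)) ∞ (fun y => TotalSpace.mk' F y (s y)) ∧
      s x = v := by
  obtain ⟨u, hu, hs⟩ := FiberBundle.exists_contMDiffOn_extend (k := ∞) I F v
  obtain ⟨f, -, hf⟩ := (SmoothBumpFunction.nhds_basis_tsupport (I := I) x).mem_iff.1
    (interior_mem_nhds.2 hu)
  exact ⟨(f : M → ℝ) • FiberBundle.extend F v,
    ContMDiffOn.smul_section_of_tsupport f.contMDiff.contMDiffOn isOpen_interior hf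
      (hs.mono interior_subset), by simp⟩

lemma exists_contMDiff_mvfderiv_eq_one {x : M} {X : TangentSpace I x} (hX : X ≠ 0) :
    ∃ g : M → ℝ, ContMDiff I 𝓘(ℝ) ∞ g ∧ g x = 0 ∧ mvfderiv I g x X = 1 := by
  obtain ⟨ℓ, hℓ⟩ : ∃ ℓ : E →L[ℝ] ℝ, ℓ X = 1 := SeparatingDual.exists_eq_one (R := ℝ) (V := E) hX
  obtain ⟨f⟩ : Nonempty (SmoothBumpFunction I x) := inferInstance
  let c : M → ℝ := fun y => ℓ (extChartAt I x y) - ℓ (extChartAt I x x)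
  have hc : ContMDiffOn I 𝓘(ℝ) ∞ c (chartAt H x).source := fun y hy =>
    ((ℓ.contMDiff.contMDiffAt.comp y (contMDiffAt_extChartAt' hy)).sub
      contMDiffAt_const).contMDiffWithinAt
  have hc' : mfderiv I 𝓘(ℝ) c x = ℓ :=
    ((ℓ.hasFDerivAt.sub_const _).hasMFDerivAt.comp x (hasMFDerivAt_extChartAt_self x)).mfderiv
  have hfc : (fun y => f y • c y) =ᶠ[𝓝 x] c := by
    filter_upwards [f.eventuallyEq_one] with y hy
    simp [hy]
  refine ⟨fun y => f y • c y, f.contMDiff_smul hc, by simp [c], ?_⟩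
  rw [mvfderiv, hfc.mfderiv_eq, hc']
  exact hℓ

end Manifold

variable {n : ℕ} {M : Type*} [TopologicalSpace M] [ChartedSpace (Model n) M]

section Pairing

variable {s : Π x : M, CotangentSpace (n := n) x} {W : Π x : M, TangentSpace (𝓡 n) x} {x : M}
  {ξ : CotangentBundle n M}

/-- A one-form on `M`, as a map `M → T^* M`. -/
abbrev sectionMap (s : Π x : M, CotangentSpace (n := n) x) : M → CotangentBundle n M :=
  fun y => ⟨y, s y⟩

/-- The inclusion `T_x^* M → T^* M` of a fibre. -/
abbrev fibreMap (x : M) : (Model n →L[ℝ] ℝ) → CotangentBundle n M :=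
  fun α => ⟨x, α⟩

/-- The function `ξ ↦ ξ(W)` on `T^* M` defined by a vector field `W` on `M`. -/
def pairing (W : Π x : M, TangentSpace (𝓡 n) x) (ξ : CotangentBundle n M) : ℝ :=
  ξ.snd (W ξ.proj)

lemma pairing_add (V W : Π x : M, TangentSpace (𝓡 n) x) :
    pairing (V + W) = pairing V + pairing W := by
  ext ξ
  simp [pairing]

lemma pairing_smul (f : M → ℝ) (W : Π x : M, TangentSpace (𝓡 n) x) :
    pairing (f • W) = (f ∘ TotalSpace.proj : CotangentBundle n M → ℝ) • pairing W := by
  ext ξ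
  simp [pairing]

variable [IsManifold (𝓡 n) ∞ M]

/-- The vector field `W` on `M` is differentiable at `x`. -/
abbrev MDiffVectorFieldAt (W : Π x : M, TangentSpace (𝓡 n) x) (x : M) : Prop :=
  MDifferentiableAt (𝓡 n) ((𝓡 n).prod 𝓘(ℝ, Model n)) (T% W) x

/-- The one-form `s` on `M` is differentiable at `x`. -/
abbrev MDiffOneFormAt (s : Π x : M, CotangentSpace (n := n) x) (x : M) : Prop :=
  MDifferentiableAt (𝓡 n) (cotModel n) (sectionMap s) x

lemma SmoothVectorField.mdifferentiableAt (hW : SmoothVectorField W) (x : M) :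
    MDiffVectorFieldAt W x :=
  hW.mdifferentiable (by simp) x

lemma SmoothOneForm.mdifferentiableAt (hs : SmoothOneForm s) (x : M) :
    MDiffOneFormAt s x :=
  hs.mdifferentiable (by simp) x

/-- The vector field which is constant, with value `v` at `x`, in the preferred chart at `x`. -/
abbrev constField (v : TangentSpace (𝓡 n) x) : Π y : M, TangentSpace (𝓡 n) y :=
  FiberBundle.extend (Model n) v

lemma mdifferentiableAt_constField (v : TangentSpace (𝓡 n) x) :
    MDiffVectorFieldAt (constField v) x :=
  FiberBundle.mdifferentiableAt_extend (V := fun x : M => TangentSpace (𝓡 n) x) (𝓡 n) (Model n) v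

lemma mdifferentiableAt_proj (ξ : CotangentBundle n M) :
    MDifferentiableAt (cotModel n) (𝓡 n) (fun η : CotangentBundle n M => η.proj) ξ :=
  Bundle.mdifferentiable_proj _ ξ

lemma mdifferentiableAt_apply (hs : MDiffOneFormAt s x)
    (hW : MDiffVectorFieldAt W x) : MDifferentiableAt (𝓡 n) 𝓘(ℝ) (fun y => s y (W y)) x :=
  ((mdifferentiableAt_totalSpace _ _).1 (MDifferentiableAt.clm_bundle_apply hs hW)).2

lemma mdifferentiableAt_pairing (hW : MDiffVectorFieldAt W ξ.proj) :
    MDifferentiableAt (cotModel n) 𝓘(ℝ) (pairing W) ξ := by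
  have hξ : MDifferentiableAt (cotModel n) (cotModel n)
      (fun η : CotangentBundle n M => (⟨η.proj, η.snd⟩ : CotangentBundle n M)) ξ :=
    mdifferentiableAt_id
  have hWξ : MDifferentiableAt (cotModel n) ((𝓡 n).prod 𝓘(ℝ, Model n))
      (fun η : CotangentBundle n M => TotalSpace.mk' (Model n) η.proj (W η.proj)) ξ :=
    MDifferentiableAt.comp ξ hW (mdifferentiableAt_proj ξ)
  exact ((mdifferentiableAt_totalSpace _ _).1 (MDifferentiableAt.clm_bundle_apply hξ hWξ)).2

lemma mdifferentiableAt_fibreMap (x : M) (α : Model n →L[ℝ] ℝ) :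
    MDifferentiableAt 𝓘(ℝ, Model n →L[ℝ] ℝ) (cotModel n) (fibreMap x) α := by
  rw [mdifferentiableAt_totalSpace]
  refine ⟨mdifferentiableAt_const, ?_⟩
  let e := trivializationAt (Model n →L[ℝ] ℝ) (fun x : M => CotangentSpace (n := n) x) x
  let L : (Model n →L[ℝ] ℝ) →L[ℝ] (Model n →L[ℝ] ℝ) := e.continuousLinearMapAt ℝ x
  have hL : ∀ β, (e (fibreMap x β)).2 = L β := fun β => by
    change _ = e.continuousLinearMapAt ℝ x β
    rw [Bundle.Trivialization.continuousLinearMapAt_apply,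
      Bundle.Trivialization.coe_linearMapAt_of_mem e
        (FiberBundle.mem_baseSet_trivializationAt' x)]
  exact L.mdifferentiableAt.congr_of_eventuallyEq (.of_forall hL)

lemma dproj_mfderiv_sectionMap
    (hs : MDiffOneFormAt s x) (X : TangentSpace (𝓡 n) x) :
    dproj (sectionMap s x) (mfderiv (𝓡 n) (cotModel n) (sectionMap s) x X) = X := by
  have h := (mdifferentiableAt_proj (sectionMap s x)).hasMFDerivAt.comp x hs.hasMFDerivAt
  exact congr($(hasMFDerivAt_unique h (hasMFDerivAt_id x)) X)

lemma mvfderiv_pairing_sectionMap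
    (hs : MDiffOneFormAt s x) (hW : MDiffVectorFieldAt W x)
    (X : TangentSpace (𝓡 n) x) :
    mvfderiv (cotModel n) (pairing W) (sectionMap s x)
      (mfderiv (𝓡 n) (cotModel n) (sectionMap s) x X) =
      mvfderiv (𝓡 n) (fun y => s y (W y)) x X :=
  congr($((mvfderiv_comp x (mdifferentiableAt_pairing hW) hs).symm) X)

lemma dproj_vertical (ξ : CotangentBundle n M) (α : CotangentSpace (n := n) ξ.proj) :
    dproj ξ (vertical ξ α) = 0 := by
  have h := (mdifferentiableAt_proj ξ).hasMFDerivAt.comp (M := Model n →L[ℝ] ℝ) ξ.snd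
    (mdifferentiableAt_fibreMap ξ.proj ξ.snd).hasMFDerivAt
  have h0 := hasMFDerivAt_const (M := Model n →L[ℝ] ℝ) (I := 𝓘(ℝ, Model n →L[ℝ] ℝ)) (I' := 𝓡 n)
    ξ.proj ξ.snd
  exact congr($(hasMFDerivAt_unique h h0) α)

lemma mvfderiv_pairing_vertical (hW : MDiffVectorFieldAt W ξ.proj)
    (α : CotangentSpace (n := n) ξ.proj) :
    mvfderiv (cotModel n) (pairing W) ξ (vertical ξ α) = α (W ξ.proj) := by
  let evalW : (Model n →L[ℝ] ℝ) →L[ℝ] ℝ := ContinuousLinearMap.apply ℝ ℝ (W ξ.proj)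
  have h := (mdifferentiableAt_pairing hW).hasMFDerivAt.comp (M := Model n →L[ℝ] ℝ) ξ.snd
    (mdifferentiableAt_fibreMap ξ.proj ξ.snd).hasMFDerivAt
  exact congr($(hasMFDerivAt_unique (M := Model n →L[ℝ] ℝ) h evalW.hasMFDerivAt) α)

end Pairing

section PreferredChart

variable [IsManifold (𝓡 n) ∞ M]

lemma mfderiv_extChartAt_symm {x : M} {u : Model n} (hu : u ∈ (extChartAt (𝓡 n) x).target)
    (v : TangentSpace (𝓡 n) x) :
    mfderiv 𝓘(ℝ, Model n) (𝓡 n) (extChartAt (𝓡 n) x).symm u v =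
      constField v ((extChartAt (𝓡 n) x).symm u) := by
  let φ := extChartAt (𝓡 n) x
  let e := trivializationAt (Model n) (TangentSpace (𝓡 n)) x
  have hy : φ.symm u ∈ (chartAt (Model n) x).source := by
    simpa only [φ, extChartAt_source] using φ.map_target hu
  have hsymmL : e.symmL ℝ (φ.symm u) = mfderiv 𝓘(ℝ, Model n) (𝓡 n) φ.symm u := by
    rw [TangentBundle.symmL_trivializationAt (𝕜 := ℝ) hy, φ.right_inv hu,
      ModelWithCorners.range_eq_univ, mfderivWithin_univ]
  have hx : (e ⟨x, v⟩).2 = v :=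
    (tangentBundleCore (𝓡 n) M).coordChange_self (achart (Model n) x) x
      (mem_chart_source (Model n) x) v
  rw [← hsymmL]
  refine (e.symmL_apply (R := ℝ) hy v).trans ?_
  conv_lhs => rw [← hx]
  rfl

lemma extChartAt_fst (ξ η : CotangentBundle n M) :
    (extChartAt (cotModel n) ξ η).1 = extChartAt (𝓡 n) ξ.proj η.proj := by
  simp only [extChartAt_coe, Function.comp_apply]
  rw [hom_chart]
  rfl

lemma dproj_apply (ξ : CotangentBundle n M) (Y : TT ξ) :
    dproj ξ Y = (show Model n × (Model n →L[ℝ] ℝ) from Y).1 := by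
  have h1 := (hasMFDerivAt_extChartAt_self (I := 𝓡 n) ξ.proj).comp ξ
    (mdifferentiableAt_proj ξ).hasMFDerivAt
  have h2 := (ContinuousLinearMap.fst ℝ (Model n) (Model n →L[ℝ] ℝ)).hasMFDerivAt.comp ξ
    (hasMFDerivAt_extChartAt_self (I := cotModel n) ξ)
  exact congr($(hasMFDerivAt_unique
    (h1.congr_of_eventuallyEq (.of_forall (extChartAt_fst ξ))) h2) Y)

lemma dproj_surjective (ξ : CotangentBundle n M) : Function.Surjective (dproj ξ) := fun v =>
  ⟨(show Model n × (Model n →L[ℝ] ℝ) from (v, 0)), dproj_apply ξ _⟩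

variable {ξ : CotangentBundle n M} {z : Model n × (Model n →L[ℝ] ℝ)}

lemma fst_mem_extChartAt_target (hz : z ∈ (extChartAt (cotModel n) ξ).target) :
    z.1 ∈ (extChartAt (𝓡 n) ξ.proj).target := by
  rw [FiberBundle.extChartAt_target] at hz
  exact hz.1.1

lemma proj_extChartAt_symm (hz : z ∈ (extChartAt (cotModel n) ξ).target) :
    ((extChartAt (cotModel n) ξ).symm z).proj = (extChartAt (𝓡 n) ξ.proj).symm z.1 := by
  rw [extChartAt_target] at hz
  exact FiberBundle.chartedSpace_chartAt_symm_fst ξ z hz.1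

lemma dproj_mfderiv_extChartAt_symm (hz : z ∈ (extChartAt (cotModel n) ξ).target) (Y : TT ξ) :
    dproj ((extChartAt (cotModel n) ξ).symm z)
      (mfderiv 𝓘(ℝ, Model n × (Model n →L[ℝ] ℝ)) (cotModel n)
        (extChartAt (cotModel n) ξ).symm z Y) =
      constField (dproj ξ Y) ((extChartAt (cotModel n) ξ).symm z).proj := by
  let ψ := extChartAt (cotModel n) ξ
  have hz₁ := fst_mem_extChartAt_target hz
  have hproj : (fun w => (ψ.symm w).proj) =ᶠ[𝓝 z] fun w => (extChartAt (𝓡 n) ξ.proj).symm w.1 := by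
    filter_upwards [(isOpen_extChartAt_target ξ).mem_nhds hz] with w hw
    exact proj_extChartAt_symm hw
  have h1 := (mdifferentiableAt_proj (ψ.symm z)).hasMFDerivAt.comp z
    (mdifferentiableAt_extChartAt_symm hz).hasMFDerivAt
  have h2 := (mdifferentiableAt_extChartAt_symm hz₁).hasMFDerivAt.comp z
    (ContinuousLinearMap.fst ℝ (Model n) (Model n →L[ℝ] ℝ)).hasMFDerivAt
  refine congr($(hasMFDerivAt_unique h1 (h2.congr_of_eventuallyEq hproj)) Y).trans ?_
  rw [proj_extChartAt_symm hz, ← mfderiv_extChartAt_symm hz₁, dproj_apply]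
  rfl

end PreferredChart

section Connector

variable [IsManifold (𝓡 n) ∞ M] {ξ : CotangentBundle n M} {x : M}

instance (ξ : CotangentBundle n M) : FiniteDimensional ℝ (TT ξ) :=
  inferInstanceAs (FiniteDimensional ℝ (Model n × (Model n →L[ℝ] ℝ)))

instance (ξ : CotangentBundle n M) : T2Space (TT ξ) :=
  inferInstanceAs (T2Space (Model n × (Model n →L[ℝ] ℝ)))

lemma tensorialAt_mvfderiv_pairing_sub (cov : Connection n M) (ξ : CotangentBundle n M)
    (Y : TT ξ) :
    TensorialAt (𝓡 n) (Model n) (fun W => mvfderiv (cotModel n) (pairing W) ξ Y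
      - ξ.snd (cov W ξ.proj (dproj ξ Y))) ξ.proj where
  smul {f W} hf hW := by
    have hfπ : mvfderiv (cotModel n) (f ∘ TotalSpace.proj) ξ Y =
        mvfderiv (𝓡 n) f ξ.proj (dproj ξ Y) :=
      mvfderiv_comp_apply ξ hf (mdifferentiableAt_proj ξ) Y
    rw [pairing_smul, mvfderiv_smul (hf.comp ξ (mdifferentiableAt_proj ξ))
      (mdifferentiableAt_pairing hW), cov.isCovariantDerivativeOnUniv.leibniz hW hf]
    simp only [Function.comp_apply, pairing, add_apply, smul_apply, smul_eq_mul,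
      ContinuousLinearMap.smulRight_apply, hfπ, map_add, map_smul, add_sub_add_right_eq_sub]
    ring
  add {V W} hV hW := by
    rw [pairing_add, mvfderiv_add (mdifferentiableAt_pairing hV) (mdifferentiableAt_pairing hW),
      cov.isCovariantDerivativeOnUniv.add hV hW]
    simp only [add_apply, map_add]
    ring

/-- The connector `K_ξ : T_ξ T^* M → T_x^* M` of the connection induced on `T^* M`, given by
`K_ξ(Y)(W) = Y.(η ↦ η(W)) - ξ(∇_{dπ Y} W)` for vector fields `W` on `M`. -/
def connector (cov : Connection n M) (ξ : CotangentBundle n M) :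
    TT ξ →L[ℝ] CotangentSpace (n := n) ξ.proj :=
  LinearMap.toContinuousLinearMap
    { toFun := fun Y => TensorialAt.mkHom _ ξ.proj (tensorialAt_mvfderiv_pairing_sub cov ξ Y)
      map_add' := fun Y Z => by
        ext v
        simp only [TensorialAt.mkHom_apply_eq_extend, ContinuousLinearMap.map_add,
          add_apply]
        ring
      map_smul' := fun c Y => by
        ext v
        simp only [TensorialAt.mkHom_apply_eq_extend, ContinuousLinearMap.map_smul, smul_eq_mul,
          smul_apply, RingHom.id_apply]
        ring }

lemma connector_apply (cov : Connection n M) (Y : TT ξ)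
    {W : Π x : M, TangentSpace (𝓡 n) x} (hW : MDiffVectorFieldAt W ξ.proj) :
    connector cov ξ Y (W ξ.proj) = mvfderiv (cotModel n) (pairing W) ξ Y
      - ξ.snd (cov W ξ.proj (dproj ξ Y)) :=
  TensorialAt.mkHom_apply (tensorialAt_mvfderiv_pairing_sub cov ξ Y) hW

lemma connector_vertical (cov : Connection n M) (α : CotangentSpace (n := n) ξ.proj) :
    connector cov ξ (vertical ξ α) = α := by
  ext v
  have h := connector_apply cov (vertical ξ α) (mdifferentiableAt_constField v)
  simpa [mvfderiv_pairing_vertical (mdifferentiableAt_constField v), dproj_vertical] using h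

lemma connector_mfderiv_sectionMap (cov : Connection n M)
    {s : Π x : M, CotangentSpace (n := n) x} {W : Π x : M, TangentSpace (𝓡 n) x}
    (hs : MDiffOneFormAt s x) (hW : MDiffVectorFieldAt W x) (X : TangentSpace (𝓡 n) x) :
    connector cov (sectionMap s x) (mfderiv (𝓡 n) (cotModel n) (sectionMap s) x X) (W x) =
      dualDeriv cov X s W := by
  rw [connector_apply cov _ hW, mvfderiv_pairing_sectionMap hs hW, dproj_mfderiv_sectionMap hs]
  rfl

lemma dproj_prod_connector_bijective (cov : Connection n M) (ξ : CotangentBundle n M) :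
    Function.Bijective ((dproj ξ).prod (connector cov ξ)) := by
  have hsurj : Function.Surjective ((dproj ξ).prod (connector cov ξ)) := fun ⟨v, α⟩ => by
    obtain ⟨Y, rfl⟩ := dproj_surjective ξ v
    refine ⟨Y + vertical ξ (α - connector cov ξ Y), Prod.ext ?_ ?_⟩
    · change dproj ξ _ = _
      rw [ContinuousLinearMap.map_add, dproj_vertical, add_zero]
    · change connector cov ξ _ = _
      rw [ContinuousLinearMap.map_add, connector_vertical, add_sub_cancel]
  exact ⟨(LinearMap.injective_iff_surjective_of_finrank_eq_finrank
    (f := ((dproj ξ).prod (connector cov ξ)).toLinearMap) rfl).2 hsurj, hsurj⟩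

/-- The decomposition `T_ξ T^* M ≃ T_x M × T_x^* M`, `Y ↦ (dπ Y, K_ξ Y)`, of the tangent spaces of
`T^* M` defined by a connection. -/
def splitting (cov : Connection n M) (ξ : CotangentBundle n M) :
    TT ξ ≃L[ℝ] TangentSpace (𝓡 n) ξ.proj × CotangentSpace (n := n) ξ.proj :=
  haveI : T2Space (TangentSpace (𝓡 n) ξ.proj) := inferInstanceAs (T2Space (Model n))
  (LinearEquiv.ofBijective ((dproj ξ).prod (connector cov ξ)).toLinearMap
    (dproj_prod_connector_bijective cov ξ)).toContinuousLinearEquiv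

lemma dproj_splitting_symm (cov : Connection n M)
    (p : TangentSpace (𝓡 n) ξ.proj × CotangentSpace (n := n) ξ.proj) :
    dproj ξ ((splitting cov ξ).symm p) = p.1 :=
  congr($((splitting cov ξ).apply_symm_apply p).1)

lemma connector_splitting_symm (cov : Connection n M)
    (p : TangentSpace (𝓡 n) ξ.proj × CotangentSpace (n := n) ξ.proj) :
    connector cov ξ ((splitting cov ξ).symm p) = p.2 :=
  congr($((splitting cov ξ).apply_symm_apply p).2)

lemma eq_of_dproj_eq_of_connector_eq (cov : Connection n M) {Y Z : TT ξ}
    (hπ : dproj ξ Y = dproj ξ Z) (hK : connector cov ξ Y = connector cov ξ Z) : Y = Z :=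
  (splitting cov ξ).injective (Prod.ext hπ hK)

end Connector

section Horizontal

variable [IsManifold (𝓡 n) ∞ M] {ξ : CotangentBundle n M} {x : M}

lemma dualDeriv_sub_smul (cov : Connection n M) {s t : Π x : M, CotangentSpace (n := n) x}
    {g : M → ℝ} {W : Π x : M, TangentSpace (𝓡 n) x} (hs : MDiffOneFormAt s x)
    (ht : MDiffOneFormAt t x) (hg : MDifferentiableAt (𝓡 n) 𝓘(ℝ) g x)
    (hW : MDiffVectorFieldAt W x) (X : TangentSpace (𝓡 n) x) :
    dualDeriv cov X (s - g • t) W = dualDeriv cov X s W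
      - (g x * dualDeriv cov X t W + mvfderiv (𝓡 n) g x X * t x (W x)) := by
  have hsW := mdifferentiableAt_apply hs hW
  have htW := mdifferentiableAt_apply ht hW
  have hst : (fun y => (s - g • t) y (W y)) =
      (fun y => s y (W y)) - g • fun y => t y (W y) := by
    ext y
    simp
  rw [dualDeriv, hst, mvfderiv_sub hsW (hg.smul htW), mvfderiv_smul hg htW]
  simp only [sub_apply, add_apply, smul_apply, smul_eq_mul, ContinuousLinearMap.smulRight_apply,
    Pi.sub_apply, Pi.smul_apply', dualDeriv]
  ring

lemma connector_eq_zero_of_mem_horizontal [T2Space M] {cov : Connection n M} {Y : TT ξ}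
    (hY : Y ∈ horizontal cov ξ) : connector cov ξ Y = 0 := by
  obtain ⟨x, p⟩ := ξ
  obtain ⟨X, s, hs, hsx, hXs, rfl⟩ := hY
  dsimp only at X hsx hXs
  subst hsx
  ext w
  obtain ⟨Z, hZ, rfl⟩ := exists_contMDiff_section (I := 𝓡 n) (F := Model n)
    (V := fun x : M => TangentSpace (𝓡 n) x) w
  exact (connector_mfderiv_sectionMap cov (hs.mdifferentiableAt x)
    (SmoothVectorField.mdifferentiableAt hZ x) X).trans (hXs Z hZ)

lemma exists_smoothOneForm [T2Space M] (α : CotangentSpace (n := n) x) :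
    ∃ s : Π y : M, CotangentSpace (n := n) y, SmoothOneForm s ∧ s x = α :=
  exists_contMDiff_section (I := 𝓡 n) (F := Model n →L[ℝ] ℝ) (V := fun x : M => CotangentSpace x) α

/-- A one-form through `α` is made parallel in the direction `X` by subtracting `g • t`, where `g`
vanishes at `x` with `dg(X) = 1` and `t` is a one-form with value `∇_X s` at `x`. -/
lemma exists_smoothOneForm_dualDeriv_eq_zero [T2Space M] (cov : Connection n M)
    (X : TangentSpace (𝓡 n) x) (α : CotangentSpace (n := n) x) :
    ∃ s : Π y : M, CotangentSpace (n := n) y, SmoothOneForm s ∧ s x = α ∧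
      ∀ Z : Π x : M, TangentSpace (𝓡 n) x, SmoothVectorField Z → dualDeriv cov X s Z = 0 := by
  obtain ⟨s, hs, rfl⟩ := exists_smoothOneForm α
  by_cases hX : X = 0
  · exact ⟨s, hs, rfl, fun Z _ => by simp [dualDeriv, hX]⟩
  have hsx := hs.mdifferentiableAt x
  obtain ⟨t, ht, htx⟩ := exists_smoothOneForm
    (connector cov (sectionMap s x) (mfderiv (𝓡 n) (cotModel n) (sectionMap s) x X))
  obtain ⟨g, hg, hgx, hgX⟩ := exists_contMDiff_mvfderiv_eq_one hX
  refine ⟨s - g • t, ContMDiff.sub_section hs (ContMDiff.smul_section hg ht), by simp [hgx],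
    fun Z hZ => ?_⟩
  have hZx := hZ.mdifferentiableAt x
  rw [dualDeriv_sub_smul cov hsx (ht.mdifferentiableAt x) (hg.mdifferentiable (by simp) x) hZx,
    htx, connector_mfderiv_sectionMap cov hsx hZx, hgx, hgX]
  ring

lemma mem_horizontal_iff [T2Space M] {cov : Connection n M} {Y : TT ξ} :
    Y ∈ horizontal cov ξ ↔ connector cov ξ Y = 0 := by
  refine ⟨connector_eq_zero_of_mem_horizontal, fun hY => ?_⟩
  obtain ⟨x, p⟩ := ξ
  obtain ⟨s, hs, rfl, hXs⟩ := exists_smoothOneForm_dualDeriv_eq_zero (x := x) cov (dproj _ Y) p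
  have hds : mfderiv (𝓡 n) (cotModel n) (sectionMap s) x (dproj _ Y) ∈
      horizontal cov (sectionMap s x) := ⟨_, s, hs, rfl, hXs, rfl⟩
  convert hds
  exact eq_of_dproj_eq_of_connector_eq cov
    (dproj_mfderiv_sectionMap (hs.mdifferentiableAt x) _).symm
    (hY.trans (connector_eq_zero_of_mem_horizontal hds).symm)

end Horizontal

section GeneralizedHorizontalLift

variable [IsManifold (𝓡 n) ∞ M] {ξ : CotangentBundle n M}

/-- The field of endomorphisms of the tangent spaces of `T^* M` which corresponds to `L ⊕ ᵗL` under
the decompositions `T_ξ T^* M ≃ T_x M × T_x^* M` defined by a connection. -/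
def splitLift (cov : Connection n M)
    (L : Π x : M, TangentSpace (𝓡 n) x →L[ℝ] TangentSpace (𝓡 n) x) : EndField n M := fun ξ =>
  (splitting cov ξ).symm.toContinuousLinearMap.comp
    (((L ξ.proj).prodMap (ContinuousLinearMap.precomp ℝ (L ξ.proj))).comp
      (splitting cov ξ).toContinuousLinearMap)

variable (cov : Connection n M)
  (L : Π x : M, TangentSpace (𝓡 n) x →L[ℝ] TangentSpace (𝓡 n) x) (Y : TT ξ)

lemma dproj_splitLift : dproj ξ (splitLift cov L ξ Y) = L ξ.proj (dproj ξ Y) :=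
  dproj_splitting_symm cov _

lemma connector_splitLift :
    connector cov ξ (splitLift cov L ξ Y) = (connector cov ξ Y).comp (L ξ.proj) :=
  connector_splitting_symm cov _

lemma isGeneralizedHorizontalLift_iff [T2Space M] (J : AlmostComplexStructure n M)
    {A : EndField n M} :
    IsGeneralizedHorizontalLift J cov A ↔ A = splitLift cov J := by
  refine ⟨fun hA => ?_, ?_⟩
  · ext ξ Y
    have hπ := dproj_splitting_symm (ξ := ξ) cov
    have hK := connector_splitting_symm (ξ := ξ) cov
    let h := (splitting cov ξ).symm (dproj ξ Y, 0)
    let h' := (splitting cov ξ).symm (J ξ.proj (dproj ξ Y), 0)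
    have hY : h + vertical ξ (connector cov ξ Y) = Y := by
      apply eq_of_dproj_eq_of_connector_eq cov
      · rw [ContinuousLinearMap.map_add, dproj_vertical, add_zero, hπ]
      · rw [ContinuousLinearMap.map_add, connector_vertical, hK, zero_add]
    have hAY := hA ξ h (mem_horizontal_iff.2 (hK _)) h' (mem_horizontal_iff.2 (hK _))
      (by rw [hπ, hπ]) (connector cov ξ Y)
    rw [hY] at hAY
    rw [hAY]
    apply eq_of_dproj_eq_of_connector_eq cov
    · rw [ContinuousLinearMap.map_add, dproj_vertical, add_zero, hπ, dproj_splitLift]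
    · rw [ContinuousLinearMap.map_add, connector_vertical, hK, zero_add, connector_splitLift]
  · rintro rfl ξ h hh h' hh' hJ α
    apply eq_of_dproj_eq_of_connector_eq cov
    · rw [dproj_splitLift, (dproj ξ).map_add, (dproj ξ).map_add, dproj_vertical, dproj_vertical,
        add_zero, add_zero, hJ]
    · rw [connector_splitLift, (connector cov ξ).map_add, (connector cov ξ).map_add,
        connector_vertical, connector_vertical, mem_horizontal_iff.1 hh, mem_horizontal_iff.1 hh',
        zero_add, zero_add]

lemma generalizedHorizontalLift_eq [T2Space M] (J : AlmostComplexStructure n M) :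
    generalizedHorizontalLift J cov = splitLift cov J :=
  epsilon_eq_of_forall_iff fun _ => isGeneralizedHorizontalLift_iff cov J

end GeneralizedHorizontalLift

section Coordinates

variable {φ : OpenPartialHomeomorph M (Model n)} {x : M}

section Frame

variable (hφ : φ ∈ IsManifold.maximalAtlas (𝓡 n) ∞ M) (hx : x ∈ φ.source)

include hφ hx

lemma isInvertible_mfderiv_of_mem_maximalAtlas :
    (mfderiv (𝓡 n) 𝓘(ℝ, Model n) φ x).IsInvertible := by
  have hφ₁ : φ ∈ IsManifold.maximalAtlas (𝓡 n) 1 M :=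
    IsManifold.maximalAtlas_subset_of_le (by simp) hφ
  have hdiff : φ.MDifferentiable (𝓡 n) (𝓡 n) :=
    ⟨fun y hy => (mdifferentiableAt_of_mem_maximalAtlas hφ₁ hy).mdifferentiableWithinAt,
      fun y hy => (mdifferentiableAt_symm_of_mem_maximalAtlas hφ₁ hy).mdifferentiableWithinAt⟩
  exact ⟨hdiff.mfderiv hx, rfl⟩

lemma mvfderiv_coordVector (i : Fin n) :
    mvfderiv (𝓡 n) φ x (coordVector φ i x) = EuclideanSpace.single i 1 :=
  (isInvertible_mfderiv_of_mem_maximalAtlas hφ hx).self_apply_inverse _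

lemma coordCovector_coordVector (i j : Fin n) :
    coordCovector φ i x (coordVector φ j x) = if i = j then 1 else 0 := by
  change mvfderiv (𝓡 n) φ x (coordVector φ j x) i = _
  rw [mvfderiv_coordVector hφ hx]
  simp

lemma sum_coordCovector_smul_coordVector (v : TangentSpace (𝓡 n) x) :
    ∑ i, coordCovector φ i x v • coordVector φ i x = v := by
  apply (isInvertible_mfderiv_of_mem_maximalAtlas hφ hx).injective
  change mvfderiv (𝓡 n) φ x _ = mvfderiv (𝓡 n) φ x v
  ext j
  simp [mvfderiv_coordVector hφ hx, coordCovector, Pi.single_apply]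

lemma apply_eq_sum_coordCovector (α : TangentSpace (𝓡 n) x →L[ℝ] ℝ) (v : TangentSpace (𝓡 n) x) :
    α v = ∑ i, coordCovector φ i x v * α (coordVector φ i x) := by
  conv_lhs => rw [← sum_coordCovector_smul_coordVector hφ hx v]
  rw [map_sum]
  exact Finset.sum_congr rfl fun i _ => α.map_smul _ _

end Frame

variable [IsManifold (𝓡 n) ∞ M] {ξ : CotangentBundle n M}

lemma mdifferentiableAt_coordVector (hφ : φ ∈ IsManifold.maximalAtlas (𝓡 n) ∞ M)
    (hx : x ∈ φ.source) (i : Fin n) : MDiffVectorFieldAt (coordVector φ i) x := by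
  have hconst : MDifferentiableAt 𝓘(ℝ, Model n) (𝓘(ℝ, Model n).prod 𝓘(ℝ, Model n))
      (fun y : Model n => (⟨y, EuclideanSpace.single i (1 : ℝ)⟩ :
        TotalSpace (Model n) (fun x : Model n => TangentSpace 𝓘(ℝ, Model n) x))) (φ x) := by
    refine (mdifferentiableAt_section (E := (TangentSpace 𝓘(ℝ, Model n) : Model n → Type))
      _ _).2 ?_
    refine (mdifferentiableAt_const (c := (EuclideanSpace.single i 1 : Model n)))
      |>.congr_of_eventuallyEq (.of_forall fun y => ?_)
    exact (Prod.ext_iff.1 (trivializationAt_model_space_apply (I := 𝓘(ℝ, Model n))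
      ⟨y, (EuclideanSpace.single i 1 : Model n)⟩ (φ x))).2
  exact hconst.mpullback_vectorField (n := ∞) (contMDiffAt_of_mem_maximalAtlas hφ hx)
    (isInvertible_mfderiv_of_mem_maximalAtlas hφ hx) (WithTop.coe_le_coe.2 le_top)

variable (hφ : φ ∈ IsManifold.maximalAtlas (𝓡 n) ∞ M) (hξ : ξ.proj ∈ φ.source)

include hφ hξ

lemma hasMFDerivAt_coord_comp_proj (i : Fin n) :
    HasMFDerivAt (cotModel n) 𝓘(ℝ) (fun η : CotangentBundle n M => φ η.proj i) ξ
      ((coordCovector φ i ξ.proj).comp (dproj ξ)) :=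
  (EuclideanSpace.proj i : Model n →L[ℝ] ℝ).hasMFDerivAt.comp ξ
    (((contMDiffAt_of_mem_maximalAtlas hφ hξ).mdifferentiableAt (by simp)).hasMFDerivAt.comp ξ
      (mdifferentiableAt_proj ξ).hasMFDerivAt)

lemma mdifferentiableAt_cotCoord :
    MDifferentiableAt (cotModel n) 𝓘(ℝ, Fin n ⊕ Fin n → ℝ) (cotCoord φ) ξ :=
  mdifferentiableAt_pi fun
    | .inl i => (hasMFDerivAt_coord_comp_proj hφ hξ i).mdifferentiableAt
    | .inr i => mdifferentiableAt_pairing (mdifferentiableAt_coordVector hφ hξ i)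

lemma hasMFDerivAt_cotCoord_apply (k : Fin n ⊕ Fin n) :
    HasMFDerivAt (cotModel n) 𝓘(ℝ) (fun η => cotCoord φ η k) ξ
      ((ContinuousLinearMap.proj k).comp (components φ ξ)) :=
  (ContinuousLinearMap.proj (R := ℝ) (φ := fun _ : Fin n ⊕ Fin n => ℝ) k).hasMFDerivAt.comp ξ
    (mdifferentiableAt_cotCoord hφ hξ).hasMFDerivAt

lemma components_inl (Y : TT ξ) (i : Fin n) :
    components φ ξ Y (.inl i) = coordCovector φ i ξ.proj (dproj ξ Y) :=
  congr($(hasMFDerivAt_unique (hasMFDerivAt_cotCoord_apply hφ hξ (.inl i))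
    (hasMFDerivAt_coord_comp_proj hφ hξ i)) Y)

lemma components_inr (Y : TT ξ) (i : Fin n) :
    components φ ξ Y (.inr i) = mvfderiv (cotModel n) (pairing (coordVector φ i)) ξ Y :=
  congr($(hasMFDerivAt_unique (hasMFDerivAt_cotCoord_apply hφ hξ (.inr i))
    (mdifferentiableAt_pairing (mdifferentiableAt_coordVector hφ hξ i)).hasMFDerivAt) Y)

lemma components_surjective : Function.Surjective (components φ ξ) := fun c => by
  obtain ⟨Y, hY⟩ := dproj_surjective ξ (∑ j, c (.inl j) • coordVector φ j ξ.proj)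
  let α : CotangentSpace (n := n) ξ.proj :=
    ∑ j, (c (.inr j) - components φ ξ Y (.inr j)) • coordCovector φ j ξ.proj
  refine ⟨Y + vertical ξ α, ?_⟩
  ext (i | i)
  · rw [components_inl hφ hξ, ContinuousLinearMap.map_add, dproj_vertical, add_zero, hY]
    simp [coordCovector_coordVector hφ hξ]
  · rw [ContinuousLinearMap.map_add, Pi.add_apply, components_inr hφ hξ (vertical ξ α),
      mvfderiv_pairing_vertical (mdifferentiableAt_coordVector hφ hξ i)]
    simp [α, sum_apply, coordCovector_coordVector hφ hξ]

lemma components_bijective : Function.Bijective (components φ ξ) := by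
  have hdual : Module.finrank ℝ (Model n →L[ℝ] ℝ) = n := by
    rw [← (LinearMap.toContinuousLinearMap (𝕜 := ℝ) (E := Model n) (F' := ℝ)).finrank_eq]
    simp
  have hdim : Module.finrank ℝ (TT ξ) = Module.finrank ℝ (Fin n ⊕ Fin n → ℝ) := by
    change Module.finrank ℝ (Model n × (Model n →L[ℝ] ℝ)) = _
    simp [Module.finrank_prod, hdual]
  have hsurj := components_surjective hφ hξ
  exact ⟨(LinearMap.injective_iff_surjective_of_finrank_eq_finrank
    (f := (components φ ξ).toLinearMap) hdim).2 hsurj, hsurj⟩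

lemma christoffelP_eq (cov : Connection n M) (i j : Fin n) :
    christoffelP cov φ ξ i j =
      ξ.snd (cov (coordVector φ j) ξ.proj (coordVector φ i ξ.proj)) := by
  rw [apply_eq_sum_coordCovector hφ hξ ξ.snd]
  exact Finset.sum_congr rfl fun k _ => mul_comm _ _

lemma sum_coordCovector_mul_christoffelP (cov : Connection n M) (v : TangentSpace (𝓡 n) ξ.proj)
    (i : Fin n) :
    ∑ l, coordCovector φ l ξ.proj v * christoffelP cov φ ξ l i =
      ξ.snd (cov (coordVector φ i) ξ.proj v) := by
  simp only [christoffelP_eq hφ hξ]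
  exact (apply_eq_sum_coordCovector hφ hξ
    (ContinuousLinearMap.comp ξ.snd (cov (coordVector φ i) ξ.proj)) v).symm

lemma components_inr_eq_connector_add (cov : Connection n M) (Y : TT ξ) (i : Fin n) :
    components φ ξ Y (.inr i) = connector cov ξ Y (coordVector φ i ξ.proj)
      + ξ.snd (cov (coordVector φ i) ξ.proj (dproj ξ Y)) := by
  rw [connector_apply cov Y (mdifferentiableAt_coordVector hφ hξ i), components_inr hφ hξ,
    sub_add_cancel]

lemma apply_J_eq_sum_JCoeff (J : AlmostComplexStructure n M) (α : CotangentSpace (n := n) ξ.proj)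
    (i : Fin n) :
    α (J ξ.proj (coordVector φ i ξ.proj)) =
      ∑ l, JCoeff J φ ξ.proj l i * α (coordVector φ l ξ.proj) :=
  apply_eq_sum_coordCovector hφ hξ α _

lemma coordCovector_apply_J (J : AlmostComplexStructure n M) (v : TangentSpace (𝓡 n) ξ.proj)
    (i : Fin n) :
    coordCovector φ i ξ.proj (J ξ.proj v) =
      ∑ j, JCoeff J φ ξ.proj i j * coordCovector φ j ξ.proj v := by
  simpa only [JCoeff, mul_comm, ContinuousLinearMap.comp_apply] using
    apply_eq_sum_coordCovector hφ hξ ((coordCovector φ i ξ.proj).comp (J ξ.proj)) v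

lemma sum_christoffelP_JCoeff (J : AlmostComplexStructure n M) (cov : Connection n M)
    (v : TangentSpace (𝓡 n) ξ.proj) (i : Fin n) :
    ∑ j, (∑ l, (christoffelP cov φ ξ l i * JCoeff J φ ξ.proj l j
        - christoffelP cov φ ξ j l * JCoeff J φ ξ.proj l i)) * coordCovector φ j ξ.proj v =
      ξ.snd (cov (coordVector φ i) ξ.proj (J ξ.proj v))
        - ∑ l, JCoeff J φ ξ.proj l i * ξ.snd (cov (coordVector φ l) ξ.proj v) := by
  simp only [← sum_coordCovector_mul_christoffelP hφ hξ, coordCovector_apply_J hφ hξ,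
    Finset.sum_mul, Finset.mul_sum]
  rw [Finset.sum_comm, ← Finset.sum_sub_distrib]
  refine Finset.sum_congr rfl fun l _ => ?_
  rw [← Finset.sum_sub_distrib]
  exact Finset.sum_congr rfl fun j _ => by ring

lemma components_splitLift (J : AlmostComplexStructure n M) (cov : Connection n M) (Y : TT ξ) :
    components φ ξ (splitLift cov J ξ Y) =
      (localMatrix J cov φ ξ).mulVec (components φ ξ Y) := by
  rw [localMatrix, Matrix.fromBlocks_mulVec]
  ext (i | i)
  · rw [components_inl hφ hξ, dproj_splitLift, coordCovector_apply_J hφ hξ]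
    simp [Matrix.mulVec, dotProduct, components_inl hφ hξ]
  · rw [components_inr_eq_connector_add hφ hξ cov, dproj_splitLift, connector_splitLift,
      ContinuousLinearMap.comp_apply, apply_J_eq_sum_JCoeff hφ hξ]
    simp only [Matrix.mulVec, dotProduct, Sum.elim_inr, Pi.add_apply, Function.comp_apply,
      Matrix.of_apply, components_inl hφ hξ, components_inr_eq_connector_add hφ hξ cov,
      sum_christoffelP_JCoeff hφ hξ, mul_add, Finset.sum_add_distrib]
    ring

end Coordinates

section ExteriorDerivative

variable [IsManifold (𝓡 n) ∞ M] {ξ : CotangentBundle n M} {x : M}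
  {L : Π x : M, TangentSpace (𝓡 n) x →L[ℝ] TangentSpace (𝓡 n) x}

/-- The one-form `θ(L)` on `T^* M` defined by a field `L` of endomorphisms, `θ(L)_ξ(Y) = ξ(L dπ Y)`;
the Liouville form is the case `L = Id`. -/
def thetaOf (L : Π x : M, TangentSpace (𝓡 n) x →L[ℝ] TangentSpace (𝓡 n) x) : OneForm n M :=
  fun ξ => (ContinuousLinearMap.comp ξ.snd (L ξ.proj)).comp (dproj ξ)

lemma inChart_thetaOf (L : Π x : M, TangentSpace (𝓡 n) x →L[ℝ] TangentSpace (𝓡 n) x)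
    {z : Model n × (Model n →L[ℝ] ℝ)} (hz : z ∈ (extChartAt (cotModel n) ξ).target) (V : TT ξ) :
    (thetaOf L).inChart ξ z V =
      pairing (fun y => L y (constField (dproj ξ V) y)) ((extChartAt (cotModel n) ξ).symm z) :=
  congrArg (fun w => (((extChartAt (cotModel n) ξ).symm z).snd (L _ w) : ℝ))
    (dproj_mfderiv_extChartAt_symm hz V)

lemma hasFDerivAt_pairing_extChartAt_symm {W : Π x : M, TangentSpace (𝓡 n) x}
    (hW : MDiffVectorFieldAt W ξ.proj) :
    HasFDerivAt (fun z => pairing W ((extChartAt (cotModel n) ξ).symm z))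
      (mvfderiv (cotModel n) (pairing W) ξ : Model n × (Model n →L[ℝ] ℝ) →L[ℝ] ℝ)
      (extChartAt (cotModel n) ξ ξ) := by
  have h : HasFDerivWithinAt (fun z => pairing W ((extChartAt (cotModel n) ξ).symm z))
      (mvfderiv (cotModel n) (pairing W) ξ : Model n × (Model n →L[ℝ] ℝ) →L[ℝ] ℝ)
      (range (cotModel n)) (extChartAt (cotModel n) ξ ξ) :=
    (mdifferentiableAt_pairing hW).hasMFDerivAt.2
  exact h.hasFDerivAt (by rw [ModelWithCorners.range_eq_univ]; exact Filter.univ_mem)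

lemma d_thetaOf_eq_mvfderiv_pairing_sub
    (hL : ∀ v : TangentSpace (𝓡 n) ξ.proj,
      MDiffVectorFieldAt (fun y => L y (constField v y)) ξ.proj) (Y Z : TT ξ) :
    (thetaOf L).d ξ Y Z =
      mvfderiv (cotModel n) (pairing fun y => L y (constField (dproj ξ Z) y)) ξ Y -
      mvfderiv (cotModel n) (pairing fun y => L y (constField (dproj ξ Y) y)) ξ Z := by
  let ψ := extChartAt (cotModel n) ξ
  have hcoeff : ∀ V : TT ξ, HasFDerivAt (fun z => (thetaOf L).inChart ξ z V)
      (mvfderiv (cotModel n) (pairing fun y => L y (constField (dproj ξ V) y)) ξ :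
        Model n × (Model n →L[ℝ] ℝ) →L[ℝ] ℝ) (ψ ξ) := fun V =>
    (hasFDerivAt_pairing_extChartAt_symm (hL (dproj ξ V))).congr_of_eventuallyEq (by
      filter_upwards [(isOpen_extChartAt_target ξ).mem_nhds (mem_extChartAt_target ξ)] with z hz
      exact inChart_thetaOf L hz V)
  have hdiff : DifferentiableAt ℝ ((thetaOf L).inChart ξ) (ψ ξ) :=
    differentiableAt_of_forall_clm_apply fun V => (hcoeff V).differentiableAt
  have hfderiv : ∀ V W : TT ξ, fderiv ℝ ((thetaOf L).inChart ξ) (ψ ξ) W V =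
      mvfderiv (cotModel n) (pairing fun y => L y (constField (dproj ξ V) y)) ξ W := fun V W =>
    fderiv_clm_apply_eq hdiff (hcoeff V) W
  have hψ : ∀ V : TT ξ, mvfderiv (cotModel n) ψ ξ V = V := fun V =>
    congr($((hasMFDerivAt_extChartAt_self ξ).mfderiv) V)
  rw [← hfderiv, ← hfderiv]
  simp only [OneForm.d]
  rw [hψ, hψ]

/-- The exterior covariant derivative `(d^∇ L)(v, w) = ∇_v (L w) - ∇_w (L v) - L [v, w]` of a
`TM`-valued one-form `L`. The vectors `v, w` are extended by vector fields which are constant in the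
preferred chart at `x`, so that their bracket vanishes. -/
def extCovDeriv (cov : Connection n M)
    (L : Π x : M, TangentSpace (𝓡 n) x →L[ℝ] TangentSpace (𝓡 n) x) (v w : TangentSpace (𝓡 n) x) :
    TangentSpace (𝓡 n) x :=
  cov (fun y => L y (constField w y)) x v - cov (fun y => L y (constField v y)) x w

lemma d_thetaOf (cov : Connection n M)
    (hL : ∀ v : TangentSpace (𝓡 n) ξ.proj,
      MDiffVectorFieldAt (fun y => L y (constField v y)) ξ.proj) (Y Z : TT ξ) :
    (thetaOf L).d ξ Y Z = connector cov ξ Y (L ξ.proj (dproj ξ Z))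
      - connector cov ξ Z (L ξ.proj (dproj ξ Y))
      + ξ.snd (extCovDeriv cov L (dproj ξ Y) (dproj ξ Z)) := by
  have hK : ∀ V W : TT ξ, connector cov ξ V (L ξ.proj (dproj ξ W)) =
      mvfderiv (cotModel n) (pairing fun y => L y (constField (dproj ξ W) y)) ξ V
        - ξ.snd (cov (fun y => L y (constField (dproj ξ W) y)) ξ.proj (dproj ξ V)) := fun V W => by
    simpa only [constField, FiberBundle.extend_apply_self] using
      connector_apply cov V (hL (dproj ξ W))
  rw [d_thetaOf_eq_mvfderiv_pairing_sub hL, hK, hK, extCovDeriv, ContinuousLinearMap.map_sub]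
  ring

lemma mlieBracket_constField (v w : TangentSpace (𝓡 n) x) :
    VectorField.mlieBracket (𝓡 n) (constField v) (constField w) x = 0 := by
  have h : ∀ v : TangentSpace (𝓡 n) x,
      VectorField.mpullbackWithin 𝓘(ℝ, Model n) (𝓡 n) (extChartAt (𝓡 n) x).symm
        (constField v) (range (𝓡 n)) =ᶠ[𝓝 (extChartAt (𝓡 n) x x)] fun _ => (v : Model n) := by
    intro v
    filter_upwards [(isOpen_extChartAt_target x).mem_nhds (mem_extChartAt_target x)] with u hu
    refine (isInvertible_mfderivWithin_extChartAt_symm hu).inverse_apply_eq.2 ?_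
    rw [ModelWithCorners.range_eq_univ, mfderivWithin_univ]
    exact (mfderiv_extChartAt_symm hu v).symm
  rw [← VectorField.mlieBracketWithin_univ, VectorField.mlieBracketWithin_apply]
  exact (congrArg _ (lieBracketWithin_eq_zero_of_eventuallyEq_const (h v) (h w))).trans
    (ContinuousLinearMap.map_zero _)

lemma extCovDeriv_id (cov : Connection n M) (v w : TangentSpace (𝓡 n) x) :
    extCovDeriv cov (fun _ => ContinuousLinearMap.id ℝ _) v w = cov.torsion x v w := by
  have h := cov.torsion_apply (mdifferentiableAt_constField v) (mdifferentiableAt_constField w)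
  rw [mlieBracket_constField, sub_zero] at h
  simp only [constField, FiberBundle.extend_apply_self] at h
  exact h.symm

lemma omegaSt_apply (cov : Connection n M) (Y Z : TT ξ) :
    omegaSt ξ Y Z = connector cov ξ Y (dproj ξ Z) - connector cov ξ Z (dproj ξ Y)
      + ξ.snd (cov.torsion ξ.proj (dproj ξ Y) (dproj ξ Z)) := by
  rw [← extCovDeriv_id cov (dproj ξ Y) (dproj ξ Z)]
  exact d_thetaOf (L := fun _ => ContinuousLinearMap.id ℝ _) cov
    (fun v => mdifferentiableAt_constField v) Y Z

lemma d_thetaJ (J : AlmostComplexStructure n M) (cov : Connection n M) (Y Z : TT ξ) :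
    (thetaJ J).d ξ Y Z = connector cov ξ Y (J ξ.proj (dproj ξ Z))
      - connector cov ξ Z (J ξ.proj (dproj ξ Y))
      + ξ.snd (extCovDeriv cov J (dproj ξ Y) (dproj ξ Z)) :=
  d_thetaOf cov (fun v => J.mdifferentiableAt_apply (mdifferentiableAt_constField v)) Y Z

lemma tensorS_apply (J : AlmostComplexStructure n M) (cov : Connection n M)
    (v w : TangentSpace (𝓡 n) x) :
    tensorS J cov x v w = cov.torsion x (J x v) w - extCovDeriv cov J v w := by
  have h : tensorS J cov x v w = SField J cov (constField v) (constField w) x := rfl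
  rw [h]
  simp only [SField, nablaJ, constField, FiberBundle.extend_apply_self]
  rw [← extCovDeriv_id cov v w]
  simp only [extCovDeriv, ContinuousLinearMap.id_apply, map_sub]
  abel

end ExteriorDerivative

section CompleteLift

variable [IsManifold (𝓡 n) ∞ M] {ξ : CotangentBundle n M}

lemma omegaSt_vertical (cov : Connection n M) (Y : TT ξ) (α : CotangentSpace (n := n) ξ.proj) :
    omegaSt ξ Y (vertical ξ α) = -α (dproj ξ Y) := by
  rw [omegaSt_apply cov, dproj_vertical, connector_vertical]
  simp only [map_zero]
  ring

lemma eq_of_forall_omegaSt_eq (cov : Connection n M) {Y Y' : TT ξ}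
    (h : ∀ Z, omegaSt ξ Y Z = omegaSt ξ Y' Z) : Y = Y' := by
  have hπ : dproj ξ Y = dproj ξ Y' := by
    refine (SeparatingDual.eq_iff_forall_dual_eq (R := ℝ) (V := Model n)).2
      fun (α : CotangentSpace ξ.proj) => ?_
    have hα := h (vertical ξ α)
    rwa [omegaSt_vertical cov, omegaSt_vertical cov, neg_inj] at hα
  refine eq_of_dproj_eq_of_connector_eq cov hπ ?_
  ext v
  obtain ⟨Z, rfl⟩ := dproj_surjective ξ v
  have hZ := h Z
  rw [omegaSt_apply cov, omegaSt_apply cov, hπ] at hZ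
  linarith

lemma dproj_gammaContraction
    (R : Π x : M, TangentSpace (𝓡 n) x →L[ℝ] TangentSpace (𝓡 n) x →L[ℝ] TangentSpace (𝓡 n) x)
    (Y : TT ξ) : dproj ξ (gammaContraction R ξ Y) = 0 :=
  dproj_vertical ξ _

lemma connector_gammaContraction (cov : Connection n M)
    (R : Π x : M, TangentSpace (𝓡 n) x →L[ℝ] TangentSpace (𝓡 n) x →L[ℝ] TangentSpace (𝓡 n) x)
    (Y : TT ξ) :
    connector cov ξ (gammaContraction R ξ Y) =
      ContinuousLinearMap.comp ξ.snd (R ξ.proj (dproj ξ Y)) :=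
  connector_vertical cov _

lemma isCompleteLift_splitLift_sub (J : AlmostComplexStructure n M) (cov : Connection n M) :
    IsCompleteLift J (splitLift cov J - gammaContraction (tensorS J cov)) := fun ξ Y Z => by
  have hsub : (splitLift cov J - gammaContraction (tensorS J cov)) ξ Y =
      splitLift cov J ξ Y - gammaContraction (tensorS J cov) ξ Y := rfl
  have hS : ξ.snd (extCovDeriv cov J (dproj ξ Y) (dproj ξ Z)) =
      ξ.snd (cov.torsion ξ.proj (J ξ.proj (dproj ξ Y)) (dproj ξ Z))
        - ξ.snd (tensorS J cov ξ.proj (dproj ξ Y) (dproj ξ Z)) := by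
    rw [tensorS_apply, ContinuousLinearMap.map_sub, sub_sub_cancel]
  rw [hsub, d_thetaJ J cov, omegaSt_apply cov, ContinuousLinearMap.map_sub,
    ContinuousLinearMap.map_sub, dproj_gammaContraction, sub_zero, dproj_splitLift,
    connector_gammaContraction, connector_splitLift, sub_apply, ContinuousLinearMap.comp_apply,
    ContinuousLinearMap.comp_apply, hS]
  ring

lemma isCompleteLift_iff {J : AlmostComplexStructure n M} (cov : Connection n M)
    {A : EndField n M} :
    IsCompleteLift J A ↔ A = splitLift cov J - gammaContraction (tensorS J cov) := by
  refine ⟨fun hA => ?_, fun hA => hA ▸ isCompleteLift_splitLift_sub J cov⟩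
  ext ξ Y
  exact eq_of_forall_omegaSt_eq cov fun Z =>
    (hA ξ Y Z).symm.trans (isCompleteLift_splitLift_sub J cov ξ Y Z)

lemma completeLift_eq (J : AlmostComplexStructure n M) (cov : Connection n M) :
    completeLift J = splitLift cov J - gammaContraction (tensorS J cov) :=
  epsilon_eq_of_forall_iff fun _ => isCompleteLift_iff cov

end CompleteLift

end CotangentLift

end

open CotangentLift in
theorem proposition2_general {n : ℕ} {M : Type*} [TopologicalSpace M] [T2Space M]
    [ChartedSpace (Model n) M] [IsManifold (𝓡 n) ∞ M]
    (J : AlmostComplexStructure n M) (cov : Connection n M) :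
    (∀ A : EndField n M,
      IsGeneralizedHorizontalLift J cov A ↔ A = generalizedHorizontalLift J cov) ∧
    (∀ A : EndField n M, IsCompleteLift J A ↔ A = completeLift J) ∧
    (∀ φ ∈ IsManifold.maximalAtlas (𝓡 n) ∞ M, ∀ ξ : CotangentBundle n M, ξ.proj ∈ φ.source →
      Function.Bijective (components φ ξ) ∧
      ∀ Y : TT ξ, components φ ξ (generalizedHorizontalLift J cov ξ Y) =
        (localMatrix J cov φ ξ).mulVec (components φ ξ Y)) ∧
    generalizedHorizontalLift J cov = completeLift J + gammaContraction (tensorS J cov) := by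
  have hG := generalizedHorizontalLift_eq cov J
  have hC := completeLift_eq J cov
  refine ⟨fun A => ?_, fun A => ?_, fun φ hφ ξ hξ => ⟨components_bijective hφ hξ, fun Y => ?_⟩, ?_⟩
  · rw [hG, isGeneralizedHorizontalLift_iff]
  · rw [hC, isCompleteLift_iff cov]
  · rw [hG, components_splitLift hφ hξ]
  · rw [hG, hC, sub_add_cancel]

open CotangentLift in
theorem proposition2 {n : ℕ} {M : Type*} [TopologicalSpace M] [T2Space M]
    [ChartedSpace (Model n) M] [IsManifold (𝓡 n) ∞ M]
    (J : AlmostComplexStructure n M) (cov : Connection n M)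
    [CovariantDerivative.ContMDiffCovariantDerivative cov ∞] :
    -- the defining properties of `J^{G,∇}` and of `J^c` each determine exactly one tensor field
    (∀ A : EndField n M,
      IsGeneralizedHorizontalLift J cov A ↔ A = generalizedHorizontalLift J cov) ∧
    (∀ A : EndField n M, IsCompleteLift J A ↔ A = completeLift J) ∧
    -- the matrix of `J^{G,∇}` in the local coordinates of `T^* M` given by any chart `φ` of `M`
    (∀ φ ∈ IsManifold.maximalAtlas (𝓡 n) ∞ M, ∀ ξ : CotangentBundle n M, ξ.proj ∈ φ.source →
      Function.Bijective (components φ ξ) ∧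
      ∀ Y : TT ξ, components φ ξ (generalizedHorizontalLift J cov ξ Y) =
        (localMatrix J cov φ ξ).mulVec (components φ ξ Y)) ∧
    -- `J^{G,∇} = J^c + γ(S)`
    generalizedHorizontalLift J cov = completeLift J + gammaContraction (tensorS J cov) :=
  proposition2_general J cov
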